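/- Let $\mathfrak n_1=\operatorname{Im}\mathbb H\oplus\mathbb H$ be the $7$-dimensional quaternionic Heisenberg Lie algebra, with basis $z_1,z_2,z_3=i,j,k$ of the center $\operatorname{Im}\mathbb H$ and basis $\tau_1,\dots,\tau_4=1,i,j,k$ of $\mathbb H$, whose only nonzero brackets (up to antisymmetry) are $[\tau_1,\tau_2]=[\tau_3,\tau_4]=z_1$, $[\tau_1,\tau_3]=[\tau_4,\tau_2]=z_2$, $[\tau_1,\tau_4]=[\tau_2,\tau_3]=z_3$, and let $N_1$ be the connected, simply connected Lie group with Lie algebra $\mathfrak n_1$. For $\lambda>0$ put $\xi_i=z_i/\lambda$, let $g$ be the left-invariant Riemannian metric on $N_1$ for which $\xi_1,\xi_2,\xi_3,\tau_1,\dots,\tau_4$ is an orthonormal frame, let $\eta_i,\theta_l$ be the dual coframe, and let $$\begin{aligned} \varphi_1&=\eta_2\otimes\xi_3-\eta_3\otimes\xi_2+\theta_1\otimes\tau_2-\theta_2\otimes\tau_1+\theta_3\otimes\tau_4-\theta_4\otimes\tau_3,\\ \varphi_2&=\eta_3\otimes\xi_1-\eta_1\otimes\xi_3+\theta_1\otimes\tau_3-\theta_3\otimes\tau_1+\theta_4\otimes\tau_2-\theta_2\otimes\tau_4,\\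 \varphi_3&=\eta_1\otimes\xi_2-\eta_2\otimes\xi_1+\theta_1\otimes\tau_4-\theta_4\otimes\tau_1+\theta_2\otimes\tau_3-\theta_3\otimes\tau_2 \end{aligned}$$ be the tensors of the almost contact metric $3$-structure $(\varphi_i,\xi_i,\eta_i)_{i=1,2,3}$ of $N_1$. For $a>0$, equip the cone $\bar N_1=N_1\times\mathbb R^+$ with the metric $\bar g_a=a^2r^2g+dr^2$ and with the three induced almost complex structures given by $J_i(ar\,\partial_r)=\xi_i$, $J_i(\xi_i)=-ar\,\partial_r$, and $J_i(X)=-\varphi_i(X)$ for $X$ orthogonal to $\xi_i$ and $\partial_r$. A Riemannian manifold with three integrable almost complex structures $I,J,K$ satisfying $IJ=K=-JI$, all compatible with the metric, is called a hyper-Kähler manifold with torsion (HKT manifold) if it admits a metric connection $\nabla$ with totally skew-symmetric torsion such that $\nabla I=\nabla J=\nabla K=0$. **Theorem.** The cone $(\bar N_1,\bar g)=(N_1\times\mathbb R^+,\lambda^2r^2g+dr^2)$, with the structures $(J_2,J_1,J_3)$ induced for $a=\lambda$, is an $8$-dimensional HKT manifold. Moreover, for $a>0$, the cone $(\bar N_1,\bar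 g_a)$ with the induced structures $(J_2,J_1,J_3)$ is an HKT manifold if and only if $a=\lambda$. -/

import Mathlib

open scoped Manifold ContDiff

noncomputable section

/-! ## Hyper-Kähler manifolds with torsion

All notions are defined for an open subset `U` of a smooth manifold `M`, which is regarded as a
manifold in its own right: tensor fields are families over `M` of which only the values on `U`
matter. For `U = Set.univ` these are the usual notions on `M`. -/

section HKT

variable {E : Type*} [NormedAddCommGroup E] [NormedSpace ℝ E]
  {H : Type*} [TopologicalSpace H] (I : ModelWithCorners ℝ E H)
  {M : Type*} [TopologicalSpace M] [ChartedSpace H M] [IsManifold I ∞ M]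

/-- The vector field `X` is smooth on `U`. -/
def IsSmoothFieldOn (U : Set M) (X : ∀ x : M, TangentSpace I x) : Prop :=
  ContMDiffOn I I.tangent ∞ (fun x => (⟨x, X x⟩ : TangentBundle I M)) U

/-- `g` is a (smooth) Riemannian metric on `U`. -/
structure IsRiemannianMetricOn (U : Set M)
    (g : ∀ x : M, TangentSpace I x →L[ℝ] TangentSpace I x →L[ℝ] ℝ) : Prop where
  smooth : ∀ X Y : (∀ x : M, TangentSpace I x), IsSmoothFieldOn I U X → IsSmoothFieldOn I U Y →
    ContMDiffOn I 𝓘(ℝ, ℝ) ∞ (fun x => g x (X x) (Y x)) U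
  symm : ∀ x ∈ U, ∀ v w : TangentSpace I x, g x v w = g x w v
  pos : ∀ x ∈ U, ∀ v : TangentSpace I x, v ≠ 0 → 0 < g x v v

/-- `J` is an integrable (smooth) almost complex structure on `U`: `J² = -1` and the Nijenhuis
tensor `[JX, JY] - J[JX, Y] - J[X, JY] - [X, Y]` vanishes. -/
structure IsComplexStructureOn (U : Set M)
    (J : ∀ x : M, TangentSpace I x →L[ℝ] TangentSpace I x) : Prop where
  smooth : ∀ X : (∀ x : M, TangentSpace I x), IsSmoothFieldOn I U X →
    IsSmoothFieldOn I U (fun x => J x (X x))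
  sq : ∀ x ∈ U, ∀ v : TangentSpace I x, J x (J x v) = -v
  nijenhuis : ∀ X Y : (∀ x : M, TangentSpace I x),
    IsSmoothFieldOn I U X → IsSmoothFieldOn I U Y → ∀ x ∈ U,
      VectorField.mlieBracket I (fun y => J y (X y)) (fun y => J y (Y y)) x
        - J x (VectorField.mlieBracket I (fun y => J y (X y)) Y x)
        - J x (VectorField.mlieBracket I X (fun y => J y (Y y)) x)
        - VectorField.mlieBracket I X Y x = 0

/-- The torsion `T(X, Y) = ∇_X Y - ∇_Y X - [X, Y]`, where `∇_X Y (x)` is `cov Y x (X x)`. -/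
def covTorsion (cov : (∀ x : M, TangentSpace I x) → ∀ x : M, TangentSpace I x →L[ℝ] TangentSpace I x)
    (X Y : ∀ x : M, TangentSpace I x) (x : M) : TangentSpace I x :=
  cov Y x (X x) - cov X x (Y x) - VectorField.mlieBracket I X Y x

/-- `cov` is a (smooth) affine connection on `U` which is metric for `g`, and whose torsion
`g(T(X, Y), Z)` is totally skew-symmetric (a `3`-form). -/
structure IsMetricSkewTorsionConnectionOn (U : Set M)
    (g : ∀ x : M, TangentSpace I x →L[ℝ] TangentSpace I x →L[ℝ] ℝ)
    (cov : (∀ x : M, TangentSpace I x) → ∀ x : M, TangentSpace I x →L[ℝ] TangentSpace I x) :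
    Prop where
  isCov : IsCovariantDerivativeOn E cov U
  smooth : ∀ X Y : (∀ x : M, TangentSpace I x), IsSmoothFieldOn I U X → IsSmoothFieldOn I U Y →
    IsSmoothFieldOn I U (fun x => cov Y x (X x))
  metric : ∀ X Y Z : (∀ x : M, TangentSpace I x), IsSmoothFieldOn I U X → IsSmoothFieldOn I U Y →
    IsSmoothFieldOn I U Z → ∀ x ∈ U,
      mfderiv I 𝓘(ℝ, ℝ) (fun y => g y (Y y) (Z y)) x (X x)
        = g x (cov Y x (X x)) (Z x) + g x (Y x) (cov Z x (X x))
  skew : ∀ X Y Z : (∀ x : M, TangentSpace I x), IsSmoothFieldOn I U X → IsSmoothFieldOn I U Y →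
    IsSmoothFieldOn I U Z → ∀ x ∈ U,
      g x (covTorsion I cov X Y x) (Z x) = - g x (covTorsion I cov X Z x) (Y x)

/-- `∇J = 0` on `U`. -/
def IsParallelOn (U : Set M)
    (cov : (∀ x : M, TangentSpace I x) → ∀ x : M, TangentSpace I x →L[ℝ] TangentSpace I x)
    (J : ∀ x : M, TangentSpace I x →L[ℝ] TangentSpace I x) : Prop :=
  ∀ X Y : (∀ x : M, TangentSpace I x), IsSmoothFieldOn I U X → IsSmoothFieldOn I U Y →
    ∀ x ∈ U, cov (fun y => J y (Y y)) x (X x) = J x (cov Y x (X x))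

/-- `(U, g, J₁, J₂, J₃)` is a hyper-Kähler manifold with torsion (HKT manifold): `J₁, J₂, J₃` are
complex structures with `J₁ J₂ = J₃ = - J₂ J₁`, the Riemannian metric `g` is Hermitian for each of
them, and there is one metric connection with totally skew-symmetric torsion for which all three
are parallel. -/
structure IsHKTOn (U : Set M)
    (g : ∀ x : M, TangentSpace I x →L[ℝ] TangentSpace I x →L[ℝ] ℝ)
    (J₁ J₂ J₃ : ∀ x : M, TangentSpace I x →L[ℝ] TangentSpace I x) : Prop where
  isOpen : IsOpen U
  riemannian : IsRiemannianMetricOn I U g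
  complex₁ : IsComplexStructureOn I U J₁
  complex₂ : IsComplexStructureOn I U J₂
  complex₃ : IsComplexStructureOn I U J₃
  quaternion₁₂ : ∀ x ∈ U, ∀ v : TangentSpace I x, J₁ x (J₂ x v) = J₃ x v
  quaternion₂₁ : ∀ x ∈ U, ∀ v : TangentSpace I x, J₂ x (J₁ x v) = - J₃ x v
  hermitian₁ : ∀ x ∈ U, ∀ v w : TangentSpace I x, g x (J₁ x v) (J₁ x w) = g x v w
  hermitian₂ : ∀ x ∈ U, ∀ v w : TangentSpace I x, g x (J₂ x v) (J₂ x w) = g x v w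
  hermitian₃ : ∀ x ∈ U, ∀ v w : TangentSpace I x, g x (J₃ x v) (J₃ x w) = g x v w
  connection :
    ∃ cov : (∀ x : M, TangentSpace I x) → ∀ x : M, TangentSpace I x →L[ℝ] TangentSpace I x,
      IsMetricSkewTorsionConnectionOn I U g cov ∧
        IsParallelOn I U cov J₁ ∧ IsParallelOn I U cov J₂ ∧ IsParallelOn I U cov J₃

end HKT

/-! ## The `7`-dimensional quaternionic Heisenberg group `N₁` -/

/-- The Lie algebra `𝔫₁ = Im ℍ ⊕ ℍ` in the basis `z₁, z₂, z₃ = i, j, k` of the center `Im ℍ` and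
`τ₁, τ₂, τ₃, τ₄ = 1, i, j, k` of `ℍ`, which is also (through the exponential map) the underlying
manifold of the connected, simply connected Lie group `N₁`. The norm is only used for its
topology and smooth structure. -/
def QHeis : Type := (Fin 3 → ℝ) × (Fin 4 → ℝ)

namespace QHeis

instance : NormedAddCommGroup QHeis :=
  inferInstanceAs (NormedAddCommGroup ((Fin 3 → ℝ) × (Fin 4 → ℝ)))

instance : NormedSpace ℝ QHeis :=
  inferInstanceAs (NormedSpace ℝ ((Fin 3 → ℝ) × (Fin 4 → ℝ)))

instance : FiniteDimensional ℝ QHeis :=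
  inferInstanceAs (FiniteDimensional ℝ ((Fin 3 → ℝ) × (Fin 4 → ℝ)))

/-- The component in the center `Im ℍ`, in coordinates. -/
def zPart : QHeis →L[ℝ] (Fin 3 → ℝ) := ContinuousLinearMap.fst ℝ (Fin 3 → ℝ) (Fin 4 → ℝ)

/-- The component in `ℍ`, in coordinates. -/
def hPart : QHeis →L[ℝ] (Fin 4 → ℝ) := ContinuousLinearMap.snd ℝ (Fin 3 → ℝ) (Fin 4 → ℝ)

/-- The vector `a + x` with `a` in the center `Im ℍ` and `x` in `ℍ`. -/
def mk (a : Fin 3 → ℝ) (x : Fin 4 → ℝ) : QHeis := (a, x)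

@[simp] theorem zPart_mk (a : Fin 3 → ℝ) (x : Fin 4 → ℝ) : zPart (mk a x) = a := rfl

@[simp] theorem hPart_mk (a : Fin 3 → ℝ) (x : Fin 4 → ℝ) : hPart (mk a x) = x := rfl

@[ext] theorem ext {p q : QHeis} (h : zPart p = zPart q) (h' : hPart p = hPart q) : p = q :=
  Prod.ext h h'

/-- The bracket `ℍ × ℍ → Im ℍ`, `⟨[x, y], a⟩ = ⟨a x, y⟩`, that is, `[x, y] = Im (y x̄)`. Its only
nonzero values on basis vectors are, up to antisymmetry, `[τ₁, τ₂] = [τ₃, τ₄] = z₁`,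
`[τ₁, τ₃] = [τ₄, τ₂] = z₂`, `[τ₁, τ₄] = [τ₂, τ₃] = z₃`. -/
def bracket (x y : Fin 4 → ℝ) : Fin 3 → ℝ :=
  ![x 0 * y 1 - x 1 * y 0 + x 2 * y 3 - x 3 * y 2,
    x 0 * y 2 - x 2 * y 0 + x 3 * y 1 - x 1 * y 3,
    x 0 * y 3 - x 3 * y 0 + x 1 * y 2 - x 2 * y 1]

/-- The group law `(a + x) (b + y) = a + b + ½ [x, y] + x + y` given by the
Baker-Campbell-Hausdorff formula. -/
instance : Mul QHeis :=
  ⟨fun p q => mk (zPart p + zPart q + (1 / 2 : ℝ) • bracket (hPart p) (hPart q))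
    (hPart p + hPart q)⟩

instance : One QHeis := ⟨0⟩

instance : Inv QHeis := ⟨fun p => -p⟩

theorem mul_def (p q : QHeis) :
    p * q = mk (zPart p + zPart q + (1 / 2 : ℝ) • bracket (hPart p) (hPart q))
      (hPart p + hPart q) := rfl

theorem one_def : (1 : QHeis) = 0 := rfl

theorem inv_def (p : QHeis) : p⁻¹ = -p := rfl

instance : Group QHeis :=
  Group.ofLeftAxioms
    (by
      intro p q r
      ext i
      · fin_cases i <;> simp [mul_def, bracket, -Matrix.add_cons, -Matrix.cons_add] <;> ring
      · simp [mul_def, add_assoc])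
    (by
      intro p
      ext i
      · fin_cases i <;> simp [mul_def, one_def, bracket, -Matrix.add_cons, -Matrix.cons_add]
      · simp [mul_def, one_def])
    (by
      intro p
      ext i
      · fin_cases i <;> simp [mul_def, one_def, inv_def, bracket] <;> ring
      · simp [mul_def, one_def, inv_def])

theorem contDiff_mk {n : ℕ∞ω} :
    ContDiff ℝ n (fun p : (Fin 3 → ℝ) × (Fin 4 → ℝ) => mk p.1 p.2) :=
  contDiff_id

theorem contDiff_mul {n : ℕ∞ω} : ContDiff ℝ n (fun p : QHeis × QHeis => p.1 * p.2) := by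
  have h : ContDiff ℝ n (fun p : QHeis × QHeis => bracket (hPart p.1) (hPart p.2)) := by
    rw [contDiff_pi]
    intro i
    fin_cases i <;> simp [bracket] <;> fun_prop
  exact contDiff_mk.comp (by fun_prop : ContDiff ℝ n (fun p : QHeis × QHeis =>
    (zPart p.1 + zPart p.2 + (1 / 2 : ℝ) • bracket (hPart p.1) (hPart p.2),
      hPart p.1 + hPart p.2)))

theorem contDiff_inv {n : ℕ∞ω} : ContDiff ℝ n (fun p : QHeis => p⁻¹) :=
  contDiff_neg

/-- `N₁` is a Lie group. -/
instance (n : ℕ∞ω) : LieGroup 𝓘(ℝ, QHeis) n QHeis where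
  contMDiff_mul := by
    rw [← modelWithCornersSelf_prod]
    have h : ContMDiff 𝓘(ℝ, QHeis × QHeis) 𝓘(ℝ, QHeis) n (fun p : QHeis × QHeis => p.1 * p.2) :=
      contDiff_mul.contMDiff
    rwa [← chartedSpaceSelf_prod] at h
  contMDiff_inv := contDiff_inv.contMDiff

/-- The basis vector `zᵢ` of `𝔫₁`. -/
def z (i : Fin 3) : QHeis := mk (Pi.single i 1) 0

/-- The basis vector `τₗ` of `𝔫₁` (counted from `0`). -/
def tau (l : Fin 4) : QHeis := mk 0 (Pi.single l 1)

/-- The differential at the identity of the left translation by `p`; it maps `v ∈ 𝔫₁` to the value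
at `p` of the left-invariant vector field defined by `v`. -/
def leftTranslation (p : QHeis) : QHeis →L[ℝ] QHeis := fderiv ℝ (fun q : QHeis => p * q) 1

/-- The Maurer-Cartan form: the differential at `p` of the left translation by `p⁻¹`. -/
def maurerCartan (p : QHeis) : QHeis →L[ℝ] QHeis := fderiv ℝ (fun q : QHeis => p⁻¹ * q) p

/-- The left-invariant vector field `ξᵢ = zᵢ / λ`. -/
def xi (lam : ℝ) (i : Fin 3) (p : QHeis) : QHeis := leftTranslation p (lam⁻¹ • z i)

/-- The left-invariant vector field `τₗ`. -/
def tauField (l : Fin 4) (p : QHeis) : QHeis := leftTranslation p (tau l)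

/-- The left-invariant `1`-form `ηᵢ` of the coframe dual to `ξ₁, ξ₂, ξ₃, τ₁, …, τ₄`. -/
def eta (lam : ℝ) (i : Fin 3) (p : QHeis) : QHeis →L[ℝ] ℝ :=
  lam • (ContinuousLinearMap.proj i ∘L zPart ∘L maurerCartan p)

/-- The left-invariant `1`-form `θₗ` of the coframe dual to `ξ₁, ξ₂, ξ₃, τ₁, …, τ₄`. -/
def theta (l : Fin 4) (p : QHeis) : QHeis →L[ℝ] ℝ :=
  ContinuousLinearMap.proj l ∘L hPart ∘L maurerCartan p

/-- The left-invariant Riemannian metric `g_λ` on `N₁` with orthonormal frame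
`ξ₁, ξ₂, ξ₃, τ₁, …, τ₄`. -/
def metric (lam : ℝ) (p : QHeis) : QHeis →L[ℝ] QHeis →L[ℝ] ℝ :=
  ∑ i : Fin 3, (eta lam i p).smulRight (eta lam i p) +
    ∑ l : Fin 4, (theta l p).smulRight (theta l p)

/-- The `(1,1)`-tensor `φᵢ` of the almost contact metric structure `(φᵢ, ξᵢ, ηᵢ)` on `N₁`, that is,
with `(i, j, k)` a cyclic permutation of `(1, 2, 3)` and with `τ, τⁱ, τʲ, τᵏ` the frame fields
that correspond to `1, i, j, k`,
`φᵢ = ηⱼ ⊗ ξₖ - ηₖ ⊗ ξⱼ + θ ⊗ τⁱ - θⁱ ⊗ τ + θʲ ⊗ τᵏ - θᵏ ⊗ τʲ`. -/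
def phi (lam : ℝ) (i : Fin 3) (p : QHeis) : QHeis →L[ℝ] QHeis :=
  (eta lam (i + 1) p).smulRight (xi lam (i + 2) p)
    - (eta lam (i + 2) p).smulRight (xi lam (i + 1) p)
    + (theta 0 p).smulRight (tauField i.succ p)
    - (theta i.succ p).smulRight (tauField 0 p)
    + (theta (i + 1).succ p).smulRight (tauField (i + 2).succ p)
    - (theta (i + 2).succ p).smulRight (tauField (i + 1).succ p)

/-! ## The cone over `N₁` -/

/-- The cone `N₁ × ℝ⁺`, as an open subset of the manifold `N₁ × ℝ`. -/
def cone : Set (QHeis × ℝ) := {q | 0 < q.2}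

/-- The cone metric `a² r² g_λ + dr²`. -/
def coneMetric (lam a : ℝ) (q : QHeis × ℝ) : (QHeis × ℝ) →L[ℝ] (QHeis × ℝ) →L[ℝ] ℝ :=
  (a ^ 2 * q.2 ^ 2) • (metric lam q.1).bilinearComp
      (ContinuousLinearMap.fst ℝ QHeis ℝ) (ContinuousLinearMap.fst ℝ QHeis ℝ)
    + (ContinuousLinearMap.snd ℝ QHeis ℝ).smulRight (ContinuousLinearMap.snd ℝ QHeis ℝ)

/-- The almost complex structure `Jᵢ` induced on the cone (with cone constant `a`) by the almost
contact metric structure `(φᵢ, ξᵢ, ηᵢ)`: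
`Jᵢ (a r ∂ᵣ) = ξᵢ`, `Jᵢ ξᵢ = - a r ∂ᵣ`, and `Jᵢ X = - φᵢ X` for `X` orthogonal to `ξᵢ` and `∂ᵣ`. -/
def coneJ (lam a : ℝ) (i : Fin 3) (q : QHeis × ℝ) : (QHeis × ℝ) →L[ℝ] (QHeis × ℝ) :=
  (-(phi lam i q.1 ∘L ContinuousLinearMap.fst ℝ QHeis ℝ)
    + (ContinuousLinearMap.snd ℝ QHeis ℝ).smulRight ((a * q.2)⁻¹ • xi lam i q.1)).prod
  (-((a * q.2) • (eta lam i q.1 ∘L ContinuousLinearMap.fst ℝ QHeis ℝ)))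

end QHeis

end

/-! The cone is the Lie group N₁ × ℝ⁺, with left-invariant frame ξᵢ, τₗ, a r ∂ᵣ. In this frame the
Jᵢ have constant matrices, independent of λ and a. The metric is a²r² times a constant scalar
product β, and the only brackets are [τₗ, τₘ] = λ · (combination of the ξᵢ), because zᵢ = λ ξᵢ. The
HKT condition thus becomes algebra for Christoffel symbols Γ: Γ commutes with each Jᵢ, β(Γ u v, w) +
β(v, Γ u w) = 2a u_r β(v, w), where u_r is the a r ∂ᵣ component, and the torsion Γ u v - Γ v u - [u,
v] is skew. Integrability and the Hermitian conditions hold for all λ, a.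

Existence (`isHKTOn_cone`): when a = λ, both the brackets and the metric condition scale by λ, so an
explicit quaternionic solution `christoffel` for λ = 1 is multiplied by λ.

Necessity (`eq_of_isHKTOn_cone`): parallelism of J₁ together with skew torsion forces β(Γ ξ₁ τ₁, τ₂)
= a - λ = β(Γ ξ₁ τ₃, τ₄) (`christoffel_eq_sub`). Parallelism of J₂ makes these two numbers opposite,
whence a = λ. -/

noncomputable section

/-! ### Differential geometry in a frame with constant structure functions. -/

section Frames

variable {E : Type*} [NormedAddCommGroup E] [NormedSpace ℝ E]

theorem isSmoothFieldOn_iff_contDiffOn {U : Set E} {X : ∀ x : E, TangentSpace 𝓘(ℝ, E) x} :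
    IsSmoothFieldOn 𝓘(ℝ, E) U X ↔ ContDiffOn ℝ ∞ (X : E → E) U :=
  contMDiffOn_vectorSpace_iff_contDiffOn

theorem mlieBracket_eq_lieBracket_vectorSpace (X Y : ∀ x : E, TangentSpace 𝓘(ℝ, E) x) (x : E) :
    VectorField.mlieBracket 𝓘(ℝ, E) X Y x = VectorField.lieBracket ℝ X Y x := by
  rw [← VectorField.mlieBracketWithin_univ, VectorField.mlieBracketWithin_eq_lieBracketWithin]
  exact congrFun VectorField.lieBracketWithin_univ x

theorem differentiableAt_of_mdifferentiableAt_section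
    {X : ∀ x : E, TangentSpace 𝓘(ℝ, E) x} {x : E}
    (h : MDifferentiableAt 𝓘(ℝ, E) 𝓘(ℝ, E).tangent
      (fun y => (⟨y, X y⟩ : TangentBundle 𝓘(ℝ, E) E)) x) : DifferentiableAt ℝ (X : E → E) x := by
  have h' := ((contMDiff_snd_tangentBundle_modelSpace (n := 1) E 𝓘(ℝ, E)).mdifferentiable
    (by simp)).mdifferentiableAt.comp x h
  exact mdifferentiableAt_iff_differentiableAt.1 h'

/-- `F` trivializes the tangent bundle over `U`, with inverse `G`, and the fields `x ↦ F x v`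
have the Lie brackets `[F v, F w] = F (c v w)`. -/
structure IsFrameOn (U : Set E) (F G : E → E →L[ℝ] E) (c : E → E → E) : Prop where
  isOpen : IsOpen U
  smooth : ContDiffOn ℝ ∞ F U
  smooth_inv : ContDiffOn ℝ ∞ G U
  left_inv : ∀ x ∈ U, ∀ v, G x (F x v) = v
  right_inv : ∀ x ∈ U, ∀ v, F x (G x v) = v
  bracket : ∀ x ∈ U, ∀ v w,
    fderiv ℝ F x (F x v) w - fderiv ℝ F x (F x w) v = F x (c v w)

namespace IsFrameOn

variable {U : Set E} {F G : E → E →L[ℝ] E} {c : E → E → E}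

theorem mem_nhds (h : IsFrameOn U F G c) {x : E} (hx : x ∈ U) : U ∈ nhds x :=
  h.isOpen.mem_nhds hx

theorem differentiableAt (h : IsFrameOn U F G c) {x : E} (hx : x ∈ U) : DifferentiableAt ℝ F x :=
  (h.smooth.contDiffAt (h.mem_nhds hx)).differentiableAt (by simp)

theorem differentiableAt_inv (h : IsFrameOn U F G c) {x : E} (hx : x ∈ U) :
    DifferentiableAt ℝ G x :=
  (h.smooth_inv.contDiffAt (h.mem_nhds hx)).differentiableAt (by simp)

theorem differentiableAt_components (h : IsFrameOn U F G c) {x : E} (hx : x ∈ U) {X : E → E}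
    (hX : DifferentiableAt ℝ X x) : DifferentiableAt ℝ (fun y => G y (X y)) x :=
  (h.differentiableAt_inv hx).clm_apply hX

theorem contDiffOn_components (h : IsFrameOn U F G c) {X : E → E}
    (hX : ContDiffOn ℝ ∞ X U) : ContDiffOn ℝ ∞ (fun y => G y (X y)) U :=
  h.smooth_inv.clm_apply hX

theorem differentiableAt_of_contDiffOn (h : IsFrameOn U F G c) {F' : Type*} [NormedAddCommGroup F']
    [NormedSpace ℝ F'] {x : E} (hx : x ∈ U) {f : E → F'}
    (hf : ContDiffOn ℝ ∞ f U) : DifferentiableAt ℝ f x :=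
  (hf.contDiffAt (h.mem_nhds hx)).differentiableAt (by simp)

theorem fderiv_field (h : IsFrameOn U F G c) {x : E} (hx : x ∈ U) {X : E → E}
    (hX : DifferentiableAt ℝ X x) (v : E) :
    fderiv ℝ X x v = fderiv ℝ F x v (G x (X x)) + F x (fderiv ℝ (fun y => G y (X y)) x v) := by
  have h1 : X =ᶠ[nhds x] fun y => F y (G y (X y)) := by
    filter_upwards [h.mem_nhds hx] with y hy using (h.right_inv y hy _).symm
  rw [h1.fderiv_eq, fderiv_clm_apply (h.differentiableAt hx) (h.differentiableAt_components hx hX)]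
  simp [add_comm]

/-- Write both fields as `F` applied to their components: differentiating the components gives the
first two terms, differentiating `F` gives the structure function `c`. -/
theorem lieBracket_field (h : IsFrameOn U F G c) {x : E} (hx : x ∈ U) {X Y : E → E}
    (hX : DifferentiableAt ℝ X x) (hY : DifferentiableAt ℝ Y x) :
    VectorField.lieBracket ℝ X Y x =
      F x (fderiv ℝ (fun y => G y (Y y)) x (X x) - fderiv ℝ (fun y => G y (X y)) x (Y x)
        + c (G x (X x)) (G x (Y x))) := by
  have h1 := h.bracket x hx (G x (X x)) (G x (Y x))
  rw [h.right_inv x hx, h.right_inv x hx] at h1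
  rw [VectorField.lieBracket_eq]
  simp only [h.fderiv_field hx hX, h.fderiv_field hx hY, map_add, map_sub, ← h1]
  abel

/-- The components of the image of a field under an endomorphism field that is constant in the
frame. -/
theorem fderiv_components_apply (h : IsFrameOn U F G c) {x : E} (hx : x ∈ U) {J : E → E →L[ℝ] E}
    {j : E →L[ℝ] E} (hJ : ∀ x ∈ U, ∀ v, J x v = F x (j (G x v))) {X : E → E}
    (hX : DifferentiableAt ℝ X x) (v : E) :
    fderiv ℝ (fun y => G y (J y (X y))) x v = j (fderiv ℝ (fun y => G y (X y)) x v) := by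
  have h1 : (fun y => G y (J y (X y))) =ᶠ[nhds x] fun y => j (G y (X y)) := by
    filter_upwards [h.mem_nhds hx] with y hy
    rw [hJ y hy, h.left_inv y hy]
  rw [h1.fderiv_eq, fderiv_fun_comp (f := fun y => G y (X y)) x j.differentiableAt
    (h.differentiableAt_components hx hX)]
  simp

theorem contDiffOn_endomorphism (h : IsFrameOn U F G c) {J : E → E →L[ℝ] E}
    {j : E →L[ℝ] E} (hJ : ∀ x ∈ U, ∀ v, J x v = F x (j (G x v))) {X : E → E}
    (hX : ContDiffOn ℝ ∞ X U) : ContDiffOn ℝ ∞ (fun y => J y (X y)) U :=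
  (h.smooth.clm_apply (j.contDiff.comp_contDiffOn (h.contDiffOn_components hX))).congr
    fun y hy => hJ y hy _

/-- The derivatives of the components cancel because `j` is constant and squares to -1. What remains
is the Nijenhuis expression of `j` for `c`, which is `hN`. -/
theorem nijenhuis_field (h : IsFrameOn U F G c) {J : E → E →L[ℝ] E}
    {j : E →L[ℝ] E} (hJ : ∀ x ∈ U, ∀ v, J x v = F x (j (G x v)))
    (hsq : ∀ v, j (j v) = -v)
    (hN : ∀ v w, c (j v) (j w) - j (c (j v) w) - j (c v (j w)) - c v w = 0)
    {X Y : E → E} (hX : ContDiffOn ℝ ∞ X U) (hY : ContDiffOn ℝ ∞ Y U) {x : E} (hx : x ∈ U) :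
    VectorField.lieBracket ℝ (fun y => J y (X y)) (fun y => J y (Y y)) x
        - J x (VectorField.lieBracket ℝ (fun y => J y (X y)) Y x)
        - J x (VectorField.lieBracket ℝ X (fun y => J y (Y y)) x)
        - VectorField.lieBracket ℝ X Y x = 0 := by
  have dX := h.differentiableAt_of_contDiffOn hx hX
  have dY := h.differentiableAt_of_contDiffOn hx hY
  have dJX := h.differentiableAt_of_contDiffOn hx (h.contDiffOn_endomorphism hJ hX)
  have dJY := h.differentiableAt_of_contDiffOn hx (h.contDiffOn_endomorphism hJ hY)
  rw [h.lieBracket_field hx dJX dJY, h.lieBracket_field hx dJX dY, h.lieBracket_field hx dX dJY,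
    h.lieBracket_field hx dX dY]
  simp only [h.fderiv_components_apply hx hJ dX, h.fderiv_components_apply hx hJ dY]
  simp only [hJ x hx, h.left_inv x hx, ← map_sub]
  convert map_zero (F x) using 2
  rw [← hN (G x (X x)) (G x (Y x))]
  simp only [map_add, map_sub, hsq]
  abel

theorem isComplexStructureOn (h : IsFrameOn U F G c)
    {J : ∀ x : E, TangentSpace 𝓘(ℝ, E) x →L[ℝ] TangentSpace 𝓘(ℝ, E) x}
    {j : E →L[ℝ] E} (hJ : ∀ x ∈ U, ∀ v : E, J x v = F x (j (G x v)))
    (hsq : ∀ v, j (j v) = -v)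
    (hN : ∀ v w, c (j v) (j w) - j (c (j v) w) - j (c v (j w)) - c v w = 0) :
    IsComplexStructureOn 𝓘(ℝ, E) U J where
  smooth X hX := isSmoothFieldOn_iff_contDiffOn.2
    (h.contDiffOn_endomorphism hJ (isSmoothFieldOn_iff_contDiffOn.1 hX))
  sq x hx (v : E) := by
    have h1 : J x (J x v) = F x (j (G x (F x (j (G x v))))) := by
      rw [← hJ x hx v]; exact hJ x hx _
    rw [h.left_inv x hx, hsq, map_neg, h.right_inv x hx] at h1
    exact h1
  nijenhuis X Y hX hY x hx := by
    rw [mlieBracket_eq_lieBracket_vectorSpace, mlieBracket_eq_lieBracket_vectorSpace,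
      mlieBracket_eq_lieBracket_vectorSpace, mlieBracket_eq_lieBracket_vectorSpace]
    exact h.nijenhuis_field hJ hsq hN (isSmoothFieldOn_iff_contDiffOn.1 hX)
      (isSmoothFieldOn_iff_contDiffOn.1 hY) hx

theorem isRiemannianMetricOn (h : IsFrameOn U F G c)
    {g : ∀ x : E, TangentSpace 𝓘(ℝ, E) x →L[ℝ] TangentSpace 𝓘(ℝ, E) x →L[ℝ] ℝ}
    {ρ : E → ℝ} {β : E →L[ℝ] E →L[ℝ] ℝ}
    (hg : ∀ x ∈ U, ∀ v w : E, g x v w = ρ x * β (G x v) (G x w))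
    (hρ : ContDiffOn ℝ ∞ ρ U) (hρ0 : ∀ x ∈ U, 0 < ρ x)
    (hsymm : ∀ v w, β v w = β w v) (hpos : ∀ v, v ≠ 0 → 0 < β v v) :
    IsRiemannianMetricOn 𝓘(ℝ, E) U g where
  smooth X Y hX hY := by
    rw [isSmoothFieldOn_iff_contDiffOn] at hX hY
    refine ContDiffOn.contMDiffOn (ContDiffOn.congr
      (f := fun x => ρ x * β (G x (X x)) (G x (Y x))) ?_ fun x hx => hg x hx _ _)
    exact hρ.mul ((β.contDiff.comp_contDiffOn (h.contDiffOn_components hX)).clm_apply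
      (h.contDiffOn_components hY))
  symm x hx (v : E) (w : E) := by
    refine (hg x hx v w).trans (Eq.trans ?_ (hg x hx w v).symm)
    rw [hsymm]
  pos x hx (v : E) hv := by
    refine lt_of_lt_of_eq ?_ (hg x hx v v).symm
    refine mul_pos (hρ0 x hx) (hpos _ fun h0 => hv ?_)
    exact (h.right_inv x hx v).symm.trans (by rw [h0]; exact map_zero (F x))

/-! ### Connections with constant Christoffel symbols. -/

/-- The connection with `∇_X Y = F (D(G Y) X + Γ (G X) (G Y))`. -/
def frameConnection (F G : E → E →L[ℝ] E) (Γ : E →L[ℝ] E →L[ℝ] E) (Y : E → E) (x : E) :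
    E →L[ℝ] E :=
  F x ∘L (fderiv ℝ (fun y => G y (Y y)) x + Γ.flip (G x (Y x)) ∘L G x)

theorem frameConnection_apply (F G : E → E →L[ℝ] E) (Γ : E →L[ℝ] E →L[ℝ] E) (Y : E → E) (x v : E) :
    frameConnection F G Γ Y x v =
      F x (fderiv ℝ (fun y => G y (Y y)) x v + Γ (G x v) (G x (Y x))) := rfl

theorem frameConnection_add (h : IsFrameOn U F G c) (Γ : E →L[ℝ] E →L[ℝ] E) {x : E} (hx : x ∈ U)
    {X Y : E → E} (hX : DifferentiableAt ℝ X x) (hY : DifferentiableAt ℝ Y x) :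
    frameConnection F G Γ (X + Y) x = frameConnection F G Γ X x + frameConnection F G Γ Y x := by
  ext v
  simp only [frameConnection_apply, map_add, Pi.add_apply, add_apply,
    fderiv_fun_add (h.differentiableAt_components hx hX) (h.differentiableAt_components hx hY)]
  abel

theorem frameConnection_smul (h : IsFrameOn U F G c) (Γ : E →L[ℝ] E →L[ℝ] E) {x : E} (hx : x ∈ U)
    {X : E → E} {f : E → ℝ} (hX : DifferentiableAt ℝ X x) (hf : DifferentiableAt ℝ f x) :
    frameConnection F G Γ (f • X) x =
      f x • frameConnection F G Γ X x + (fderiv ℝ f x).smulRight (X x) := by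
  ext v
  simp only [frameConnection_apply, map_add, map_smul, Pi.smul_apply', add_apply,
    fderiv_fun_smul hf (h.differentiableAt_components hx hX), ContinuousLinearMap.smulRight_apply,
    h.right_inv x hx, smul_add, smul_apply]
  abel

theorem isCovariantDerivativeOn (h : IsFrameOn U F G c) (Γ : E →L[ℝ] E →L[ℝ] E) :
    IsCovariantDerivativeOn (I := 𝓘(ℝ, E)) (V := TangentSpace 𝓘(ℝ, E)) E
      (frameConnection F G Γ) U where
  add {X Y x} hX hY hx := h.frameConnection_add Γ hx
    (differentiableAt_of_mdifferentiableAt_section hX)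
    (differentiableAt_of_mdifferentiableAt_section hY)
  leibniz {X f x} hX hf hx := by
    refine (h.frameConnection_smul Γ hx (differentiableAt_of_mdifferentiableAt_section hX)
      (mdifferentiableAt_iff_differentiableAt.1 hf)).trans ?_
    rw [← mfderiv_eq_fderiv]
    rfl

theorem contDiffOn_frameConnection (h : IsFrameOn U F G c) (Γ : E →L[ℝ] E →L[ℝ] E) {X Y : E → E}
    (hX : ContDiffOn ℝ ∞ X U) (hY : ContDiffOn ℝ ∞ Y U) :
    ContDiffOn ℝ ∞ (fun x => frameConnection F G Γ Y x (X x)) U := by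
  have h1 : ContDiffOn ℝ ∞ (fun x => fderiv ℝ (fun y => G y (Y y)) x) U :=
    (h.contDiffOn_components hY).fderiv_of_isOpen h.isOpen (by simp)
  exact h.smooth.clm_apply ((h1.clm_apply hX).add
    ((Γ.contDiff.comp_contDiffOn (h.contDiffOn_components hX)).clm_apply
      (h.contDiffOn_components hY)))

theorem frameConnection_torsion (h : IsFrameOn U F G c) (Γ : E →L[ℝ] E →L[ℝ] E) {X Y : E → E}
    {x : E} (hx : x ∈ U) (hX : DifferentiableAt ℝ X x) (hY : DifferentiableAt ℝ Y x) :
    frameConnection F G Γ Y x (X x) - frameConnection F G Γ X x (Y x)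
        - VectorField.lieBracket ℝ X Y x =
      F x (Γ (G x (X x)) (G x (Y x)) - Γ (G x (Y x)) (G x (X x)) - c (G x (X x)) (G x (Y x))) := by
  rw [h.lieBracket_field hx hX hY, frameConnection_apply, frameConnection_apply, ← map_sub,
    ← map_sub]
  congr 1
  abel

/-- The frame is only conformal for the metric: `δ` is the logarithmic derivative of the conformal
factor `ρ` along the frame fields, and it is the same at all points. -/
theorem fderiv_metric (h : IsFrameOn U F G c) {g : E → E →L[ℝ] E →L[ℝ] ℝ}
    {ρ : E → ℝ} {β : E →L[ℝ] E →L[ℝ] ℝ} {δ : E → ℝ}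
    (hg : ∀ x ∈ U, ∀ v w : E, g x v w = ρ x * β (G x v) (G x w))
    (hρ : ContDiffOn ℝ ∞ ρ U) (hδ : ∀ x ∈ U, ∀ v, fderiv ℝ ρ x (F x v) = ρ x * δ v)
    {x : E} (hx : x ∈ U) {Y Z : E → E}
    (hY : DifferentiableAt ℝ Y x) (hZ : DifferentiableAt ℝ Z x) (v : E) :
    fderiv ℝ (fun y => g y (Y y) (Z y)) x v =
      ρ x * (δ (G x v) * β (G x (Y x)) (G x (Z x))
        + β (fderiv ℝ (fun y => G y (Y y)) x v) (G x (Z x))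
        + β (G x (Y x)) (fderiv ℝ (fun y => G y (Z y)) x v)) := by
  have h1 : (fun y => g y (Y y) (Z y)) =ᶠ[nhds x] fun y => ρ y * β (G y (Y y)) (G y (Z y)) := by
    filter_upwards [h.mem_nhds hx] with y hy using hg y hy _ _
  have dρ := h.differentiableAt_of_contDiffOn hx hρ
  have dY := h.differentiableAt_components hx hY
  have dZ := h.differentiableAt_components hx hZ
  have dβY : DifferentiableAt ℝ (fun y => β (G y (Y y))) x := DifferentiableAt.comp x β.differentiableAt dY
  have h2 := hδ x hx (G x v)
  rw [h.right_inv x hx] at h2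
  rw [h1.fderiv_eq, fderiv_fun_mul dρ (dβY.clm_apply dZ), fderiv_clm_apply dβY dZ,
    fderiv_fun_comp (f := fun y => G y (Y y)) x β.differentiableAt dY]
  simp [h2]
  ring

theorem fderiv_metric_frameConnection (h : IsFrameOn U F G c) {g : E → E →L[ℝ] E →L[ℝ] ℝ}
    {ρ : E → ℝ} {β : E →L[ℝ] E →L[ℝ] ℝ} {δ : E → ℝ} {Γ : E →L[ℝ] E →L[ℝ] E}
    (hg : ∀ x ∈ U, ∀ v w : E, g x v w = ρ x * β (G x v) (G x w))
    (hρ : ContDiffOn ℝ ∞ ρ U) (hδ : ∀ x ∈ U, ∀ v, fderiv ℝ ρ x (F x v) = ρ x * δ v)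
    (hΓ : ∀ u v w, β (Γ u v) w + β v (Γ u w) = δ u * β v w)
    {x : E} (hx : x ∈ U) {Y Z : E → E}
    (hY : DifferentiableAt ℝ Y x) (hZ : DifferentiableAt ℝ Z x) (v : E) :
    fderiv ℝ (fun y => g y (Y y) (Z y)) x v =
      g x (frameConnection F G Γ Y x v) (Z x) + g x (Y x) (frameConnection F G Γ Z x v) := by
  rw [h.fderiv_metric hg hρ hδ hx hY hZ, hg x hx, hg x hx]
  simp only [frameConnection_apply, h.left_inv x hx, map_add, add_apply]
  rw [← hΓ]
  ring

theorem frameConnection_torsion_skew (h : IsFrameOn U F G c) {g : E → E →L[ℝ] E →L[ℝ] ℝ}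
    {ρ : E → ℝ} {β : E →L[ℝ] E →L[ℝ] ℝ} {Γ : E →L[ℝ] E →L[ℝ] E}
    (hg : ∀ x ∈ U, ∀ v w : E, g x v w = ρ x * β (G x v) (G x w))
    (hT : ∀ u v w, β (Γ u v - Γ v u - c u v) w = -β (Γ u w - Γ w u - c u w) v)
    {x : E} (hx : x ∈ U) {X Y Z : E → E} (hX : DifferentiableAt ℝ X x)
    (hY : DifferentiableAt ℝ Y x) (hZ : DifferentiableAt ℝ Z x) :
    g x (frameConnection F G Γ Y x (X x) - frameConnection F G Γ X x (Y x)
        - VectorField.lieBracket ℝ X Y x) (Z x) =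
      -g x (frameConnection F G Γ Z x (X x) - frameConnection F G Γ X x (Z x)
        - VectorField.lieBracket ℝ X Z x) (Y x) := by
  rw [h.frameConnection_torsion Γ hx hX hY, h.frameConnection_torsion Γ hx hX hZ, hg x hx, hg x hx,
    h.left_inv x hx, h.left_inv x hx, hT, mul_neg]

theorem isMetricSkewTorsionConnectionOn (h : IsFrameOn U F G c)
    {g : ∀ x : E, TangentSpace 𝓘(ℝ, E) x →L[ℝ] TangentSpace 𝓘(ℝ, E) x →L[ℝ] ℝ}
    {ρ : E → ℝ} {β : E →L[ℝ] E →L[ℝ] ℝ} {δ : E → ℝ} {Γ : E →L[ℝ] E →L[ℝ] E}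
    (hg : ∀ x ∈ U, ∀ v w : E, g x v w = ρ x * β (G x v) (G x w))
    (hρ : ContDiffOn ℝ ∞ ρ U) (hδ : ∀ x ∈ U, ∀ v, fderiv ℝ ρ x (F x v) = ρ x * δ v)
    (hΓ : ∀ u v w, β (Γ u v) w + β v (Γ u w) = δ u * β v w)
    (hT : ∀ u v w, β (Γ u v - Γ v u - c u v) w = -β (Γ u w - Γ w u - c u w) v) :
    IsMetricSkewTorsionConnectionOn 𝓘(ℝ, E) U g (frameConnection F G Γ) where
  isCov := h.isCovariantDerivativeOn Γ
  smooth X Y hX hY := isSmoothFieldOn_iff_contDiffOn.2 (h.contDiffOn_frameConnection Γ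
    (isSmoothFieldOn_iff_contDiffOn.1 hX) (isSmoothFieldOn_iff_contDiffOn.1 hY))
  metric X Y Z hX hY hZ x hx := by
    have dY := h.differentiableAt_of_contDiffOn hx (isSmoothFieldOn_iff_contDiffOn.1 hY)
    have dZ := h.differentiableAt_of_contDiffOn hx (isSmoothFieldOn_iff_contDiffOn.1 hZ)
    rw [mfderiv_eq_fderiv]
    exact h.fderiv_metric_frameConnection hg hρ hδ hΓ hx dY dZ (X x)
  skew X Y Z hX hY hZ x hx := by
    have dX := h.differentiableAt_of_contDiffOn hx (isSmoothFieldOn_iff_contDiffOn.1 hX)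
    have dY := h.differentiableAt_of_contDiffOn hx (isSmoothFieldOn_iff_contDiffOn.1 hY)
    have dZ := h.differentiableAt_of_contDiffOn hx (isSmoothFieldOn_iff_contDiffOn.1 hZ)
    unfold covTorsion
    rw [mlieBracket_eq_lieBracket_vectorSpace, mlieBracket_eq_lieBracket_vectorSpace]
    exact h.frameConnection_torsion_skew hg hT hx dX dY dZ

theorem frameConnection_endomorphism (h : IsFrameOn U F G c) {J : E → E →L[ℝ] E}
    {j : E →L[ℝ] E} {Γ : E →L[ℝ] E →L[ℝ] E} (hJ : ∀ x ∈ U, ∀ v : E, J x v = F x (j (G x v)))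
    (hj : ∀ v w, Γ v (j w) = j (Γ v w)) {x : E} (hx : x ∈ U) {Y : E → E}
    (hY : DifferentiableAt ℝ Y x) (v : E) :
    frameConnection F G Γ (fun y => J y (Y y)) x v = J x (frameConnection F G Γ Y x v) := by
  rw [frameConnection_apply, h.fderiv_components_apply hx hJ hY, frameConnection_apply, hJ x hx,
    hJ x hx, h.left_inv x hx, h.left_inv x hx, hj, map_add j]

theorem isParallelOn (h : IsFrameOn U F G c)
    {J : ∀ x : E, TangentSpace 𝓘(ℝ, E) x →L[ℝ] TangentSpace 𝓘(ℝ, E) x}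
    {j : E →L[ℝ] E} {Γ : E →L[ℝ] E →L[ℝ] E} (hJ : ∀ x ∈ U, ∀ v : E, J x v = F x (j (G x v)))
    (hj : ∀ v w, Γ v (j w) = j (Γ v w)) :
    IsParallelOn 𝓘(ℝ, E) U (frameConnection F G Γ) J := by
  intro X Y hX hY x hx
  have dY := h.differentiableAt_of_contDiffOn hx (isSmoothFieldOn_iff_contDiffOn.1 hY)
  exact h.frameConnection_endomorphism hJ hj hx dY (X x)

/-- The Christoffel symbols of a metric connection with skew torsion, in a frame. -/
theorem exists_christoffel (h : IsFrameOn U F G c)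
    {g : ∀ x : E, TangentSpace 𝓘(ℝ, E) x →L[ℝ] TangentSpace 𝓘(ℝ, E) x →L[ℝ] ℝ}
    {ρ : E → ℝ} {β : E →L[ℝ] E →L[ℝ] ℝ} {δ : E → ℝ}
    {cov : (∀ x : E, TangentSpace 𝓘(ℝ, E) x) →
      ∀ x : E, TangentSpace 𝓘(ℝ, E) x →L[ℝ] TangentSpace 𝓘(ℝ, E) x}
    (hcov : IsMetricSkewTorsionConnectionOn 𝓘(ℝ, E) U g cov)
    (hg : ∀ x ∈ U, ∀ v w : E, g x v w = ρ x * β (G x v) (G x w))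
    (hρ : ContDiffOn ℝ ∞ ρ U) (hρ0 : ∀ x ∈ U, 0 < ρ x)
    (hδ : ∀ x ∈ U, ∀ v, fderiv ℝ ρ x (F x v) = ρ x * δ v) (hU : U.Nonempty) :
    ∃ Γ : E → E → E, (∀ u v w, β (Γ u v) w + β v (Γ u w) = δ u * β v w) ∧
      (∀ u v w, β (Γ u v - Γ v u - c u v) w = -β (Γ u w - Γ w u - c u w) v) ∧
      ∀ (J : ∀ x : E, TangentSpace 𝓘(ℝ, E) x →L[ℝ] TangentSpace 𝓘(ℝ, E) x) (j : E →L[ℝ] E),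
        (∀ x ∈ U, ∀ v : E, J x v = F x (j (G x v))) → IsParallelOn 𝓘(ℝ, E) U cov J →
        ∀ v w, Γ v (j w) = j (Γ v w) := by
  obtain ⟨x, hx⟩ := hU
  have hF (v : E) : ContDiffOn ℝ ∞ (fun y => F y v) U := h.smooth.clm_apply contDiffOn_const
  have hF' (v : E) : IsSmoothFieldOn 𝓘(ℝ, E) U (fun y => F y v) :=
    isSmoothFieldOn_iff_contDiffOn.2 (hF v)
  have dF (v : E) := h.differentiableAt_of_contDiffOn hx (hF v)
  have hGF (v : E) : fderiv ℝ (fun y => G y (F y v)) x = 0 := by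
    have h1 : (fun y => G y (F y v)) =ᶠ[nhds x] fun _ => v := by
      filter_upwards [h.mem_nhds hx] with y hy using h.left_inv y hy v
    rw [h1.fderiv_eq, fderiv_fun_const, Pi.zero_apply]
  let D (Y : E → E) (v : E) : E := cov Y x v
  have hD (Y : E → E) (v : E) : D Y v = cov Y x v := rfl
  -- The Christoffel symbols are read off at the single point `x`. The connection need not be
  -- constant in the frame, since the conditions on `Γ` are pointwise.
  refine ⟨fun v w => G x (D (fun y => F y w) (F x v)), fun u v w => ?_, fun u v w => ?_,
    fun J j hJ hp v w => ?_⟩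
  · have h1 := hcov.metric _ _ _ (hF' u) (hF' v) (hF' w) x hx
    rw [mfderiv_eq_fderiv] at h1
    have h2 := ((h.fderiv_metric hg hρ hδ hx (dF v) (dF w) (F x u)).symm.trans h1).trans
      (congrArg₂ (· + ·) (hg x hx _ _) (hg x hx _ _))
    simp only [hGF, h.left_inv x hx, ← hD, zero_apply, map_zero, add_zero] at h2
    rw [← mul_add] at h2
    exact (mul_left_cancel₀ (hρ0 x hx).ne' h2).symm
  · have hb (u v : E) : VectorField.lieBracket ℝ (fun y => F y u) (fun y => F y v) x
        = F x (c u v) := by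
      rw [h.lieBracket_field hx (dF u) (dF v), hGF, hGF, h.left_inv x hx, h.left_inv x hx]
      simp
    have hT (u v : E) : G x (covTorsion 𝓘(ℝ, E) cov (fun y => F y u) (fun y => F y v) x) =
        G x (D (fun y => F y v) (F x u)) - G x (D (fun y => F y u) (F x v)) - c u v := by
      unfold covTorsion
      have h3 : VectorField.mlieBracket 𝓘(ℝ, E) (fun y => F y u) (fun y => F y v) x = F x (c u v) :=
        (mlieBracket_eq_lieBracket_vectorSpace _ _ _).trans (hb u v)
      refine ((G x).map_sub _ _).trans (congrArg₂ (· - ·) ((G x).map_sub _ _) ?_)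
      exact (congrArg (G x) h3).trans (h.left_inv x hx _)
    have h1 := hcov.skew _ _ _ (hF' u) (hF' v) (hF' w) x hx
    have h2 := ((hg x hx _ _).symm.trans h1).trans (congrArg Neg.neg (hg x hx _ _))
    rw [hT, hT, h.left_inv x hx, h.left_inv x hx, ← mul_neg] at h2
    exact mul_left_cancel₀ (hρ0 x hx).ne' h2
  · have hm {X : E → E} (hX : ContDiffOn ℝ ∞ X U) : MDifferentiableAt 𝓘(ℝ, E) 𝓘(ℝ, E).tangent
        (fun y => (⟨y, X y⟩ : TangentBundle 𝓘(ℝ, E) E)) x :=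
      ((isSmoothFieldOn_iff_contDiffOn.2 hX).contMDiffAt (h.mem_nhds hx)).mdifferentiableAt
        (by simp)
    -- The two fields agree only on `U`, so the locality of the connection is needed.
    have h1 : cov (fun y => F y (j w)) x = cov (fun y => J y (F y w)) x :=
      hcov.isCov.congr_of_eqOn (hm (hF _)) (hm (h.contDiffOn_endomorphism hJ (hF w)))
        (h.mem_nhds hx) fun y hy => by
          refine Eq.trans ?_ (hJ y hy _).symm
          rw [h.left_inv y hy]
    have h2 : D (fun y => F y (j w)) (F x v) = J x (D (fun y => F y w) (F x v)) :=
      (DFunLike.congr_fun h1 _).trans (hp _ _ (hF' v) (hF' w) x hx)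
    refine (congrArg (G x) h2).trans ((congrArg (G x) (hJ x hx _)).trans (h.left_inv x hx _))

end IsFrameOn

end Frames

namespace QHeis

/-! ### Left translations in coordinates -/

theorem coneModel_ext {v w : QHeis × ℝ} (hz : ∀ i, zPart v.1 i = zPart w.1 i)
    (hh : ∀ l, hPart v.1 l = hPart w.1 l) (hs : v.2 = w.2) : v = w :=
  Prod.ext (QHeis.ext (funext hz) (funext hh)) hs

/-- The vector `a + x` as a continuous linear function of `(a, x)`. -/
def mkL : ((Fin 3 → ℝ) × (Fin 4 → ℝ)) →L[ℝ] QHeis :=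
  ContinuousLinearMap.id ℝ ((Fin 3 → ℝ) × (Fin 4 → ℝ))

@[simp] theorem mkL_apply (p : (Fin 3 → ℝ) × (Fin 4 → ℝ)) : mkL p = mk p.1 p.2 := rfl

/-- The bracket as a continuous bilinear map. -/
def bracketL : (Fin 4 → ℝ) →L[ℝ] (Fin 4 → ℝ) →L[ℝ] (Fin 3 → ℝ) :=
  (LinearMap.mk₂ ℝ bracket
    (fun x x' y => by
      ext i; fin_cases i <;> simp [bracket, -Matrix.add_cons, -Matrix.cons_add] <;> ring)
    (fun c x y => by ext i; fin_cases i <;> simp [bracket, -Matrix.smul_cons] <;> ring)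
    (fun x y y' => by
      ext i; fin_cases i <;> simp [bracket, -Matrix.add_cons, -Matrix.cons_add] <;> ring)
    (fun c x y => by
      ext i; fin_cases i <;> simp [bracket, -Matrix.smul_cons] <;> ring)).toContinuousBilinearMap

@[simp] theorem bracketL_apply (x y : Fin 4 → ℝ) : bracketL x y = bracket x y := rfl

@[simp] theorem bracket_zero_left (y : Fin 4 → ℝ) : bracket 0 y = 0 := by
  rw [← bracketL_apply, map_zero, zero_apply]

@[simp] theorem bracket_zero_right (x : Fin 4 → ℝ) : bracket x 0 = 0 := by
  rw [← bracketL_apply, map_zero]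

/-- The linear part of the left translation by `p`. -/
def leftTranslationL (p : QHeis) : QHeis →L[ℝ] QHeis :=
  mkL ∘L (zPart + (1 / 2 : ℝ) • bracketL (hPart p) ∘L hPart).prod hPart

@[simp] theorem leftTranslationL_apply (p v : QHeis) : leftTranslationL p v =
    mk (zPart v + (1 / 2 : ℝ) • bracket (hPart p) (hPart v)) (hPart v) := rfl

/-- The group law is affine in its second factor, so the differential is the same at every `q`. This
serves both `leftTranslation` and `maurerCartan`. -/
theorem hasFDerivAt_mul_left (p q : QHeis) :
    HasFDerivAt (fun q : QHeis => p * q) (leftTranslationL p) q := by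
  have h : (fun q : QHeis => p * q) = fun q => p + leftTranslationL p q := by
    funext q
    ext i
    · simp [mul_def, add_assoc]
    · simp [mul_def]
  rw [h]
  exact (leftTranslationL p).hasFDerivAt.const_add p

@[simp] theorem leftTranslation_apply (p v : QHeis) : leftTranslation p v =
    mk (zPart v + (1 / 2 : ℝ) • bracket (hPart p) (hPart v)) (hPart v) := by
  rw [leftTranslation, (hasFDerivAt_mul_left p 1).fderiv, leftTranslationL_apply]

@[simp] theorem maurerCartan_apply (p v : QHeis) : maurerCartan p v =
    mk (zPart v - (1 / 2 : ℝ) • bracket (hPart p) (hPart v)) (hPart v) := by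
  rw [maurerCartan, (hasFDerivAt_mul_left p⁻¹ p).fderiv, leftTranslationL_apply, inv_def, map_neg,
    ← bracketL_apply, map_neg, neg_apply, smul_neg, ← sub_eq_add_neg,
    bracketL_apply]

/-! ### The left-invariant frame of the cone -/

/-- The frame of the cone that consists of `ξ₁, ξ₂, ξ₃, τ₁, …, τ₄, a r ∂ᵣ`. -/
def coneFrame (lam a : ℝ) (q : QHeis × ℝ) : (QHeis × ℝ) →L[ℝ] (QHeis × ℝ) :=
  (mkL ∘L (lam⁻¹ • zPart + (1 / 2 : ℝ) • bracketL (hPart q.1) ∘L hPart).prod hPart ∘L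
    ContinuousLinearMap.fst ℝ QHeis ℝ).prod ((a * q.2) • ContinuousLinearMap.snd ℝ QHeis ℝ)

/-- The dual coframe of `coneFrame`. -/
def coneCoframe (lam a : ℝ) (q : QHeis × ℝ) : (QHeis × ℝ) →L[ℝ] (QHeis × ℝ) :=
  (mkL ∘L (lam • (zPart - (1 / 2 : ℝ) • bracketL (hPart q.1) ∘L hPart)).prod hPart ∘L
    ContinuousLinearMap.fst ℝ QHeis ℝ).prod ((a * q.2)⁻¹ • ContinuousLinearMap.snd ℝ QHeis ℝ)

@[simp] theorem coneFrame_apply (lam a : ℝ) (q v : QHeis × ℝ) : coneFrame lam a q v =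
    (mk (lam⁻¹ • zPart v.1 + (1 / 2 : ℝ) • bracket (hPart q.1) (hPart v.1)) (hPart v.1),
      a * q.2 * v.2) := rfl

@[simp] theorem coneCoframe_apply (lam a : ℝ) (q v : QHeis × ℝ) : coneCoframe lam a q v =
    (mk (lam • (zPart v.1 - (1 / 2 : ℝ) • bracket (hPart q.1) (hPart v.1))) (hPart v.1),
      (a * q.2)⁻¹ * v.2) := rfl

/-- The bracket of the frame fields of the cone. -/
def coneBracket (lam : ℝ) (v w : QHeis × ℝ) : QHeis × ℝ :=
  (mk (lam • bracket (hPart v.1) (hPart w.1)) 0, 0)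

theorem contDiff_coneFrame (lam a : ℝ) : ContDiff ℝ ∞ (coneFrame lam a) := by
  rw [contDiff_clm_apply_iff]
  intro v
  have h : (fun q => coneFrame lam a q v) = fun q : QHeis × ℝ => (mkL (lam⁻¹ • zPart v.1 +
      (1 / 2 : ℝ) • bracketL (hPart q.1) (hPart v.1), hPart v.1), a * q.2 * v.2) := rfl
  rw [h]
  fun_prop

theorem contDiffOn_coneCoframe (lam : ℝ) {a : ℝ} (ha : 0 < a) :
    ContDiffOn ℝ ∞ (coneCoframe lam a) cone := by
  rw [contDiffOn_clm_apply]
  intro v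
  have h : (fun q => coneCoframe lam a q v) = fun q : QHeis × ℝ => (mkL (lam • (zPart v.1 -
      (1 / 2 : ℝ) • bracketL (hPart q.1) (hPart v.1)), hPart v.1), (a * q.2)⁻¹ * v.2) := rfl
  rw [h]
  have h1 : ContDiffOn ℝ ∞ (fun q : QHeis × ℝ => (a * q.2)⁻¹) cone :=
    ContDiffOn.inv (by fun_prop) fun q hq => (mul_pos ha hq).ne'
  fun_prop

theorem fderiv_coneFrame (lam a : ℝ) (q u v : QHeis × ℝ) : fderiv ℝ (coneFrame lam a) q u v =
    (mk ((1 / 2 : ℝ) • bracket (hPart u.1) (hPart v.1)) 0, a * u.2 * v.2) := by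
  -- For fixed `v` the frame field is affine in `q`, and `D` is its linear part.
  let D : (QHeis × ℝ) →L[ℝ] (QHeis × ℝ) :=
    (mkL ∘L ((1 / 2 : ℝ) • bracketL.flip (hPart v.1) ∘L hPart).prod 0 ∘L
      ContinuousLinearMap.fst ℝ QHeis ℝ).prod ((a * v.2) • ContinuousLinearMap.snd ℝ QHeis ℝ)
  have hD (u : QHeis × ℝ) : D u =
      (mk ((1 / 2 : ℝ) • bracket (hPart u.1) (hPart v.1)) 0, a * v.2 * u.2) := rfl
  have h1 : (fun q => coneFrame lam a q v) =
      fun q => (mk (lam⁻¹ • zPart v.1) (hPart v.1), 0) + D q := by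
    funext q
    refine coneModel_ext (fun i => ?_) (fun l => ?_) ?_
    · simp [hD]
    · simp [hD]
    · simp [hD]; ring
  have h2 := fderiv_clm_apply (u := fun _ : QHeis × ℝ => v) (x := q)
    ((contDiff_coneFrame lam a).differentiable (by simp) q) (differentiableAt_const v)
  rw [h1, fderiv_const_add, D.fderiv] at h2
  have h3 := DFunLike.congr_fun h2 u
  simp only [fderiv_fun_const, Pi.zero_apply, ContinuousLinearMap.comp_zero, zero_add,
    ContinuousLinearMap.flip_apply] at h3
  rw [← h3, hD]
  ring_nf

theorem isFrameOn_cone {lam a : ℝ} (hlam : 0 < lam) (ha : 0 < a) :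
    IsFrameOn cone (coneFrame lam a) (coneCoframe lam a) (coneBracket lam) where
  isOpen := isOpen_lt continuous_const continuous_snd
  smooth := (contDiff_coneFrame lam a).contDiffOn
  smooth_inv := contDiffOn_coneCoframe lam ha
  left_inv q hq v := by
    have h : q.2 ≠ 0 := ne_of_gt hq
    refine coneModel_ext (fun i => ?_) (fun l => ?_) ?_ <;> simp <;> field_simp
  right_inv q hq v := by
    have h : q.2 ≠ 0 := ne_of_gt hq
    refine coneModel_ext (fun i => ?_) (fun l => ?_) ?_ <;> simp <;> field_simp
    ring
  bracket q hq v w := by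
    -- The two halves from the group law add up to the full bracket, and `lam` converts zᵢ into ξᵢ.
    -- The radial terms are symmetric in `v`, `w` and cancel.
    rw [fderiv_coneFrame, fderiv_coneFrame]
    refine coneModel_ext (fun i => ?_) (fun l => ?_) ?_
    · fin_cases i <;> simp [coneBracket, bracket] <;> field_simp <;> ring
    · simp [coneBracket]
    · simp [coneBracket]; ring

/-! ### The tensors of the cone in the frame -/

/-- The matrix of the almost complex structures in the frame `coneFrame`. -/
def modelJ (i : Fin 3) : (QHeis × ℝ) →L[ℝ] (QHeis × ℝ) := coneJ 1 1 i (1, 1)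

/-- The standard scalar product, which makes the frame `coneFrame` conformal. -/
def modelMetric : (QHeis × ℝ) →L[ℝ] (QHeis × ℝ) →L[ℝ] ℝ := coneMetric 1 1 (1, 1)

theorem modelMetric_apply (v w : QHeis × ℝ) : modelMetric v w =
    ∑ i, zPart v.1 i * zPart w.1 i + ∑ l, hPart v.1 l * hPart w.1 l + v.2 * w.2 := by
  simp [modelMetric, coneMetric, metric, eta, theta, one_def]

theorem coneMetric_eq {lam a : ℝ} (ha : 0 < a) {q : QHeis × ℝ} (hq : q ∈ cone)
    (v w : QHeis × ℝ) : coneMetric lam a q v w =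
      a ^ 2 * q.2 ^ 2 * modelMetric (coneCoframe lam a q v) (coneCoframe lam a q w) := by
  have h : q.2 ≠ 0 := ne_of_gt hq
  rw [modelMetric_apply]
  simp [coneMetric, metric, eta, theta]
  field_simp
  simp only [mul_comm (2 : ℝ)]

theorem modelJ_zero_apply (v : QHeis × ℝ) : modelJ 0 v =
    (mk ![v.2, zPart v.1 2, -zPart v.1 1]
      ![hPart v.1 1, -hPart v.1 0, hPart v.1 3, -hPart v.1 2], -zPart v.1 0) := by
  refine coneModel_ext (fun i => ?_) (fun l => ?_) ?_
  · fin_cases i <;> simp [modelJ, coneJ, phi, xi, eta, theta, tauField, z, tau, one_def]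
  · fin_cases l <;> simp [modelJ, coneJ, phi, xi, eta, theta, tauField, z, tau, one_def]
  · simp [modelJ, coneJ, eta, one_def]

theorem modelJ_one_apply (v : QHeis × ℝ) : modelJ 1 v =
    (mk ![-zPart v.1 2, v.2, zPart v.1 0]
      ![hPart v.1 2, -hPart v.1 3, -hPart v.1 0, hPart v.1 1], -zPart v.1 1) := by
  refine coneModel_ext (fun i => ?_) (fun l => ?_) ?_
  · fin_cases i <;> simp [modelJ, coneJ, phi, xi, eta, theta, tauField, z, tau, one_def]
  · fin_cases l <;> simp [modelJ, coneJ, phi, xi, eta, theta, tauField, z, tau, one_def]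
  · simp [modelJ, coneJ, eta, one_def]

theorem modelJ_two_apply (v : QHeis × ℝ) : modelJ 2 v =
    (mk ![zPart v.1 1, -zPart v.1 0, v.2]
      ![hPart v.1 3, hPart v.1 2, -hPart v.1 1, -hPart v.1 0], -zPart v.1 2) := by
  refine coneModel_ext (fun i => ?_) (fun l => ?_) ?_
  · fin_cases i <;> simp [modelJ, coneJ, phi, xi, eta, theta, tauField, z, tau, one_def]
  · fin_cases l <;> simp [modelJ, coneJ, phi, xi, eta, theta, tauField, z, tau, one_def]
  · simp [modelJ, coneJ, eta, one_def]

/-- The frame absorbs all dependence on `lam`, `a` and the point, so the matrix may be evaluated at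
λ = a = r = 1 and the identity of N₁, where the frame is the standard basis. -/
theorem coneJ_eq {lam a : ℝ} (hlam : 0 < lam) (ha : 0 < a) (i : Fin 3) {q : QHeis × ℝ}
    (hq : q ∈ cone) (v : QHeis × ℝ) : coneJ lam a i q v =
      coneFrame lam a q (modelJ i (coneCoframe lam a q v)) := by
  have h : q.2 ≠ 0 := ne_of_gt hq
  have h' : a ≠ 0 := ha.ne'
  have h'' : lam ≠ 0 := hlam.ne'
  have hxi (i : Fin 3) : xi lam i q.1 = mk (lam⁻¹ • Pi.single i 1) 0 := by
    ext <;> simp [xi, z]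
  have htau (l : Fin 4) : tauField l q.1 =
      mk ((1 / 2 : ℝ) • bracket (hPart q.1) (Pi.single l 1)) (Pi.single l 1) := by
    simp [tauField, tau]
  fin_cases i
  · refine coneModel_ext (fun i => ?_) (fun l => ?_) ?_
    · simp [modelJ_zero_apply, coneJ, phi, hxi, htau, eta, theta]
      fin_cases i <;> simp [bracket] <;> field_simp <;> ring
    · simp [modelJ_zero_apply, coneJ, phi, hxi, htau, theta]
      fin_cases l <;> simp
    · simp [modelJ_zero_apply, coneJ, eta]
  · refine coneModel_ext (fun i => ?_) (fun l => ?_) ?_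
    · simp [modelJ_one_apply, coneJ, phi, hxi, htau, eta, theta]
      fin_cases i <;> simp [bracket] <;> field_simp <;> ring
    · simp [modelJ_one_apply, coneJ, phi, hxi, htau, theta]
      fin_cases l <;> simp
    · simp [modelJ_one_apply, coneJ, eta]
  · refine coneModel_ext (fun i => ?_) (fun l => ?_) ?_
    · simp [modelJ_two_apply, coneJ, phi, hxi, htau, eta, theta]
      fin_cases i <;> simp [bracket] <;> field_simp <;> ring
    · simp [modelJ_two_apply, coneJ, phi, hxi, htau, theta]
      fin_cases l <;> simp
    · simp [modelJ_two_apply, coneJ, eta]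

/-! ### The quaternionic solution for λ = 1 and the algebra of the model. -/

/-- The Christoffel symbols of the HKT connection for `λ = 1`, in the frame `coneFrame`. On the
quaternions `s + z` this is the quaternionic product. -/
def christoffelFun (v w : QHeis × ℝ) : QHeis × ℝ :=
  (mk
    ![zPart v.1 1 * zPart w.1 2 - zPart v.1 2 * zPart w.1 1 + zPart v.1 0 * w.2 + v.2 * zPart w.1 0
        + hPart v.1 0 * hPart w.1 1 - hPart v.1 1 * hPart w.1 0
        + hPart v.1 2 * hPart w.1 3 - hPart v.1 3 * hPart w.1 2,
      zPart v.1 2 * zPart w.1 0 - zPart v.1 0 * zPart w.1 2 + zPart v.1 1 * w.2 + v.2 * zPart w.1 1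
        + hPart v.1 0 * hPart w.1 2 - hPart v.1 2 * hPart w.1 0
        + hPart v.1 3 * hPart w.1 1 - hPart v.1 1 * hPart w.1 3,
      zPart v.1 0 * zPart w.1 1 - zPart v.1 1 * zPart w.1 0 + zPart v.1 2 * w.2 + v.2 * zPart w.1 2
        + hPart v.1 0 * hPart w.1 3 - hPart v.1 3 * hPart w.1 0
        + hPart v.1 1 * hPart w.1 2 - hPart v.1 2 * hPart w.1 1]
    ![hPart v.1 0 * w.2 + hPart v.1 1 * zPart w.1 0 + hPart v.1 2 * zPart w.1 1
        + hPart v.1 3 * zPart w.1 2 + v.2 * hPart w.1 0,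
      -hPart v.1 0 * zPart w.1 0 + hPart v.1 1 * w.2 + hPart v.1 2 * zPart w.1 2
        - hPart v.1 3 * zPart w.1 1 + v.2 * hPart w.1 1,
      -hPart v.1 0 * zPart w.1 1 - hPart v.1 1 * zPart w.1 2 + hPart v.1 2 * w.2
        + hPart v.1 3 * zPart w.1 0 + v.2 * hPart w.1 2,
      -hPart v.1 0 * zPart w.1 2 + hPart v.1 1 * zPart w.1 1 - hPart v.1 2 * zPart w.1 0
        + hPart v.1 3 * w.2 + v.2 * hPart w.1 3],
    v.2 * w.2 - (zPart v.1 0 * zPart w.1 0 + zPart v.1 1 * zPart w.1 1 + zPart v.1 2 * zPart w.1 2)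
      - (hPart v.1 0 * hPart w.1 0 + hPart v.1 1 * hPart w.1 1 + hPart v.1 2 * hPart w.1 2
        + hPart v.1 3 * hPart w.1 3))

/-- The Christoffel symbols `christoffelFun` as a continuous bilinear map. -/
def christoffel : (QHeis × ℝ) →L[ℝ] (QHeis × ℝ) →L[ℝ] (QHeis × ℝ) :=
  (LinearMap.mk₂ ℝ christoffelFun
    (fun v v' w => by
      refine coneModel_ext (fun i => ?_) (fun l => ?_) ?_
      · fin_cases i <;> simp [christoffelFun] <;> ring
      · fin_cases l <;> simp [christoffelFun] <;> ring
      · simp [christoffelFun]; ring)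
    (fun c v w => by
      refine coneModel_ext (fun i => ?_) (fun l => ?_) ?_
      · fin_cases i <;> simp [christoffelFun] <;> ring
      · fin_cases l <;> simp [christoffelFun] <;> ring
      · simp [christoffelFun]; ring)
    (fun v w w' => by
      refine coneModel_ext (fun i => ?_) (fun l => ?_) ?_
      · fin_cases i <;> simp [christoffelFun] <;> ring
      · fin_cases l <;> simp [christoffelFun] <;> ring
      · simp [christoffelFun]; ring)
    (fun c v w => by
      refine coneModel_ext (fun i => ?_) (fun l => ?_) ?_
      · fin_cases i <;> simp [christoffelFun] <;> ring
      · fin_cases l <;> simp [christoffelFun] <;> ring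
      · simp [christoffelFun]; ring)).toContinuousBilinearMap

theorem christoffel_apply (v w : QHeis × ℝ) : christoffel v w = christoffelFun v w := rfl

/-- With p = s + z and x the horizontal part, the symbols read Γ((p, x), (w, y)) = (p w - x ȳ, w̄ x
+ Re(p) y). Left multiplication by p and the scalar Re(p) are conformal with factor 2 Re(p), and the
mixed terms cancel since ⟨y, w̄ x⟩ = ⟨x ȳ, w⟩. -/
theorem christoffel_metric (u v w : QHeis × ℝ) :
    modelMetric (christoffel u v) w + modelMetric v (christoffel u w) =
      2 * u.2 * modelMetric v w := by
  simp [modelMetric_apply, christoffel_apply, christoffelFun, Fin.sum_univ_three, Fin.sum_univ_four]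
  ring

/-- The torsion has no radial part: it is 2 z × z' on Im ℍ, [x, y] on ℍ, and z y for z in Im ℍ and y
in ℍ. It is skew by ⟨[x, y], z⟩ = ⟨z x, y⟩. -/
theorem christoffel_torsion_skew (u v w : QHeis × ℝ) :
    modelMetric (christoffel u v - christoffel v u - coneBracket 1 u v) w =
      -modelMetric (christoffel u w - christoffel w u - coneBracket 1 u w) v := by
  simp [modelMetric_apply, christoffel_apply, christoffelFun, coneBracket, bracket,
    Fin.sum_univ_three, Fin.sum_univ_four]
  ring

/-- The structures multiply s + z on the right by i, j, k and ℍ on the left by -i, -j, -k. The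
products p w, x ȳ and w̄ x respect this by associativity. -/
theorem christoffel_modelJ (i : Fin 3) (v w : QHeis × ℝ) :
    christoffel v (modelJ i w) = modelJ i (christoffel v w) := by
  rw [christoffel_apply, christoffel_apply]
  fin_cases i
  · refine coneModel_ext (fun i => ?_) (fun l => ?_) ?_
    · fin_cases i <;> simp [modelJ_zero_apply, christoffelFun] <;> ring
    · fin_cases l <;> simp [modelJ_zero_apply, christoffelFun] <;> ring
    · simp [modelJ_zero_apply, christoffelFun]; ring
  · refine coneModel_ext (fun i => ?_) (fun l => ?_) ?_
    · fin_cases i <;> simp [modelJ_one_apply, christoffelFun] <;> ring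
    · fin_cases l <;> simp [modelJ_one_apply, christoffelFun] <;> ring
    · simp [modelJ_one_apply, christoffelFun]; ring
  · refine coneModel_ext (fun i => ?_) (fun l => ?_) ?_
    · fin_cases i <;> simp [modelJ_two_apply, christoffelFun] <;> ring
    · fin_cases l <;> simp [modelJ_two_apply, christoffelFun] <;> ring
    · simp [modelJ_two_apply, christoffelFun]; ring

theorem modelJ_modelJ (i : Fin 3) (v : QHeis × ℝ) : modelJ i (modelJ i v) = -v := by
  fin_cases i <;> refine coneModel_ext (fun i => ?_) (fun l => ?_) ?_ <;>
    first | fin_cases i | fin_cases l | skip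
  all_goals simp [modelJ_zero_apply, modelJ_one_apply, modelJ_two_apply]

theorem modelJ_one_zero (v : QHeis × ℝ) : modelJ 1 (modelJ 0 v) = modelJ 2 v := by
  refine coneModel_ext (fun i => ?_) (fun l => ?_) ?_
  · fin_cases i <;> simp [modelJ_zero_apply, modelJ_one_apply, modelJ_two_apply]
  · fin_cases l <;> simp [modelJ_zero_apply, modelJ_one_apply, modelJ_two_apply]
  · simp [modelJ_zero_apply, modelJ_one_apply, modelJ_two_apply]

theorem modelJ_zero_one (v : QHeis × ℝ) : modelJ 0 (modelJ 1 v) = -modelJ 2 v := by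
  refine coneModel_ext (fun i => ?_) (fun l => ?_) ?_
  · fin_cases i <;> simp [modelJ_zero_apply, modelJ_one_apply, modelJ_two_apply]
  · fin_cases l <;> simp [modelJ_zero_apply, modelJ_one_apply, modelJ_two_apply]
  · simp [modelJ_zero_apply, modelJ_one_apply, modelJ_two_apply]

theorem modelMetric_modelJ (i : Fin 3) (v w : QHeis × ℝ) :
    modelMetric (modelJ i v) (modelJ i w) = modelMetric v w := by
  fin_cases i <;>
    simp [modelJ_zero_apply, modelJ_one_apply, modelJ_two_apply, modelMetric_apply,
      Fin.sum_univ_three, Fin.sum_univ_four] <;> ring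

theorem modelMetric_comm (v w : QHeis × ℝ) : modelMetric v w = modelMetric w v := by
  simp [modelMetric_apply, mul_comm]

theorem modelMetric_pos {v : QHeis × ℝ} (hv : v ≠ 0) : 0 < modelMetric v v := by
  have h1 : 0 ≤ ∑ i, zPart v.1 i * zPart v.1 i := Finset.sum_nonneg fun i _ => mul_self_nonneg _
  have h2 : 0 ≤ ∑ l, hPart v.1 l * hPart v.1 l := Finset.sum_nonneg fun i _ => mul_self_nonneg _
  have h3 : 0 ≤ v.2 * v.2 := mul_self_nonneg _
  rw [modelMetric_apply]
  refine lt_of_le_of_ne (by positivity) fun h0 => hv ?_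
  have e1 : ∑ i, zPart v.1 i * zPart v.1 i = 0 := by linarith
  have e2 : ∑ l, hPart v.1 l * hPart v.1 l = 0 := by linarith
  have e3 : v.2 * v.2 = 0 := by linarith
  rw [Finset.sum_eq_zero_iff_of_nonneg fun i _ => mul_self_nonneg _] at e1 e2
  refine coneModel_ext (fun i => ?_) (fun l => ?_) ?_
  · simpa using e1 i (Finset.mem_univ i)
  · simpa using e2 l (Finset.mem_univ l)
  · simpa using e3

/-- On ℍ the i-th component of the bracket is invariant under Jᵢ in both arguments, and the other
two components change sign. The identity is linear in the bracket, so integrability does not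
restrict `lam`. -/
theorem modelJ_nijenhuis (lam : ℝ) (i : Fin 3) (v w : QHeis × ℝ) :
    coneBracket lam (modelJ i v) (modelJ i w) - modelJ i (coneBracket lam (modelJ i v) w)
      - modelJ i (coneBracket lam v (modelJ i w)) - coneBracket lam v w = 0 := by
  fin_cases i <;> refine coneModel_ext (fun i => ?_) (fun l => ?_) ?_ <;>
    first | fin_cases i | fin_cases l | skip
  all_goals
    simp [modelJ_zero_apply, modelJ_one_apply, modelJ_two_apply, coneBracket, bracket]
    try ring

/-- The Christoffel symbol `⟨Γ e p, q⟩` of a metric connection with skew torsion for which `j` is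
parallel, if `j q = p`, `j s = e` and `[p, q] = λ e`. -/
theorem christoffel_eq_sub {E : Type*} [NormedAddCommGroup E] [NormedSpace ℝ E]
    {β : E →L[ℝ] E →L[ℝ] ℝ} {δ : E → ℝ} {c Γ : E → E → E} {j : E →L[ℝ] E} {lam a : ℝ}
    {e p q s : E} (hβ : ∀ v w, β v w = β w v)
    (hΓ : ∀ u v w, β (Γ u v) w + β v (Γ u w) = δ u * β v w)
    (hT : ∀ u v w, β (Γ u v - Γ v u - c u v) w = -β (Γ u w - Γ w u - c u w) v)
    (hj : ∀ v w, Γ v (j w) = j (Γ v w)) (hjβ : ∀ v w, β (j v) (j w) = β v w)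
    (hq : j q = p) (hs : j s = e) (he : j e = -s)
    (hδs : δ s = 2 * a) (hδp : δ p = 0) (hδq : δ q = 0)
    (hpp : β p p = 1) (hqq : β q q = 1) (hee : β e e = 1)
    (hcpq : c p q = lam • e) (hcpe : c p e = 0) (hcps : c p s = 0) (hcqs : c q s = 0)
    (hcpp : c p p = 0) (hcqq : c q q = 0) :
    β (Γ e p) q = a - lam := by
  have hΓ' (u v w : E) : β (Γ u v) w + β (Γ u w) v = δ u * β v w := by rw [← hΓ, hβ v]
  -- Skew torsion gives β(Γ x s, x) = β(Γ s x, x), which is a by the metric condition along the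
  -- radial vector `s`. The metric condition along `x` then moves the derivative to the other slot.
  have key (x : E) (hx : β x x = 1) (hδx : δ x = 0) (hxs : c x s = 0) (hxx : c x x = 0) :
      β (Γ x x) s = -a := by
    have h1 := hT x s x
    have h2 := hΓ' s x x
    have h3 := hΓ' x x s
    rw [hδs, hx] at h2
    simp only [hxs, hxx, hδx, sub_self, sub_zero, map_sub, sub_apply, map_zero, zero_apply,
      neg_zero, zero_mul] at h1 h3
    linarith
  -- Since `j` is parallel and isometric, it carries the pairs (p, s) and (q, s) of `key` to the
  -- mixed symbols.
  have h1 : β (Γ p q) e = a := by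
    rw [← hjβ, ← hj, hq, he, map_neg, key p hpp hδp hcps hcpp, neg_neg]
  have h2 : β (Γ q p) e = -a := by
    rw [← hq, hj, ← hs, hjβ, key q hqq hδq hcqs hcqq]
  have h3 := hΓ' p q e
  have h4 := hT p q e
  simp only [hcpq, hcpe, hδp, hee, h1, h2, sub_zero, map_sub, sub_apply, map_smul, smul_apply,
    smul_eq_mul, zero_mul, mul_one] at h3 h4
  -- By `h1` and `h2`, the torsion of (p, q, e) is 2a - λ. By skewness it also equals a + β(Γ e p,
  -- q).
  linarith

/-! ### The two directions of the theorem. -/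

theorem contDiff_coneFactor (a : ℝ) : ContDiff ℝ ∞ (fun q : QHeis × ℝ => a ^ 2 * q.2 ^ 2) := by
  fun_prop

theorem fderiv_coneFactor (lam a : ℝ) (q v : QHeis × ℝ) :
    fderiv ℝ (fun q : QHeis × ℝ => a ^ 2 * q.2 ^ 2) q (coneFrame lam a q v) =
      a ^ 2 * q.2 ^ 2 * (2 * a * v.2) := by
  have h1 : HasFDerivAt (fun q : QHeis × ℝ => q.2) (ContinuousLinearMap.snd ℝ QHeis ℝ) q :=
    hasFDerivAt_snd
  rw [((h1.pow 2).const_mul (a ^ 2)).fderiv]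
  simp
  ring

theorem coneBracket_eq_smul (lam : ℝ) (v w : QHeis × ℝ) :
    coneBracket lam v w = lam • coneBracket 1 v w := by
  refine coneModel_ext (fun i => ?_) (fun l => ?_) ?_ <;> simp [coneBracket]

theorem isHKTOn_cone {lam : ℝ} (hlam : 0 < lam) :
    IsHKTOn 𝓘(ℝ, QHeis × ℝ) cone (coneMetric lam lam)
      (coneJ lam lam 1) (coneJ lam lam 0) (coneJ lam lam 2) := by
  have h := isFrameOn_cone hlam hlam
  have hJ (i : Fin 3) := fun q hq v => coneJ_eq hlam hlam i (q := q) hq v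
  have hg := fun q hq v w => coneMetric_eq (lam := lam) hlam (q := q) hq v w
  have hρ := (contDiff_coneFactor lam).contDiffOn (s := cone)
  have hcomplex (i : Fin 3) : IsComplexStructureOn 𝓘(ℝ, QHeis × ℝ) cone (coneJ lam lam i) :=
    h.isComplexStructureOn (hJ i) (modelJ_modelJ i) (modelJ_nijenhuis lam i)
  have hherm (i : Fin 3) (q : QHeis × ℝ) (hq : q ∈ cone) (v w : QHeis × ℝ) :
      coneMetric lam lam q (coneJ lam lam i q v) (coneJ lam lam i q w) =
        coneMetric lam lam q v w := by
    rw [hg q hq, hg q hq, hJ i q hq, hJ i q hq, h.left_inv q hq, h.left_inv q hq,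
      modelMetric_modelJ]
  -- The factor `lam` matches both the bracket, which scales by λ, and the conformal term, which
  -- scales by a; this is where a = λ enters.
  have hpar (i : Fin 3) : IsParallelOn 𝓘(ℝ, QHeis × ℝ) cone
      (IsFrameOn.frameConnection (coneFrame lam lam) (coneCoframe lam lam) (lam • christoffel))
      (coneJ lam lam i) :=
    h.isParallelOn (hJ i) fun v w => by
      simp [christoffel_modelJ]
  refine ⟨h.isOpen, ?_, hcomplex 1, hcomplex 0, hcomplex 2, fun q hq v => ?_, fun q hq v => ?_,
    hherm 1, hherm 0, hherm 2, _, ?_, hpar 1, hpar 0, hpar 2⟩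
  · exact h.isRiemannianMetricOn hg hρ
      (fun q hq => by have : 0 < q.2 := hq; positivity) modelMetric_comm fun v => modelMetric_pos
  · have h1 (v : QHeis × ℝ) : coneJ lam lam 1 q (coneJ lam lam 0 q v) = coneJ lam lam 2 q v := by
      rw [hJ 0 q hq, hJ 1 q hq, hJ 2 q hq, h.left_inv q hq, modelJ_one_zero]
    exact h1 v
  · have h1 (v : QHeis × ℝ) : coneJ lam lam 0 q (coneJ lam lam 1 q v) = -coneJ lam lam 2 q v := by
      rw [hJ 0 q hq, hJ 1 q hq, hJ 2 q hq, h.left_inv q hq, modelJ_zero_one, map_neg]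
    exact h1 v
  · refine h.isMetricSkewTorsionConnectionOn hg hρ (fun q _ v => fderiv_coneFactor lam lam q v)
      (fun u v w => ?_) (fun u v w => ?_)
    · have h1 := christoffel_metric u v w
      simp only [smul_apply, map_smul, smul_eq_mul]
      linear_combination lam * h1
    · have h1 := christoffel_torsion_skew u v w
      simp only [coneBracket_eq_smul lam, smul_apply, ← smul_sub, map_smul, smul_eq_mul, h1]
      ring

theorem eq_of_isHKTOn_cone {lam a : ℝ} (hlam : 0 < lam) (ha : 0 < a)
    (H : IsHKTOn 𝓘(ℝ, QHeis × ℝ) cone (coneMetric lam a)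
      (coneJ lam a 1) (coneJ lam a 0) (coneJ lam a 2)) : a = lam := by
  obtain ⟨cov, hcov, hp1, hp0, -⟩ := H.connection
  have h := isFrameOn_cone hlam ha
  have hJ (i : Fin 3) := fun q hq v => coneJ_eq hlam ha i (q := q) hq v
  obtain ⟨Γ, hΓ, hT, hj⟩ := h.exists_christoffel hcov
    (fun q hq v w => coneMetric_eq (lam := lam) ha (q := q) hq v w)
    (contDiff_coneFactor a).contDiffOn (fun q hq => by have : 0 < q.2 := hq; positivity)
    (fun q _ v => fderiv_coneFactor lam a q v) ⟨(0, 1), show (0 : ℝ) < 1 from one_pos⟩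
  have hj0 := hj _ _ (hJ 0) hp0
  have hj1 := hj _ _ (hJ 1) hp1
  have ext_iff' (v w : QHeis × ℝ) : v = w ↔ (∀ i, zPart v.1 i = zPart w.1 i) ∧
      (∀ l, hPart v.1 l = hPart w.1 l) ∧ v.2 = w.2 :=
    ⟨by rintro rfl; simp, fun h => coneModel_ext h.1 h.2.1 h.2.2⟩
  have h01 : modelMetric (Γ (z 0, 0) (tau 0, 0)) (tau 1, 0) = a - lam := by
    apply christoffel_eq_sub (s := (0, 1)) modelMetric_comm hΓ hT hj0 (modelMetric_modelJ 0) <;>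
      simp [ext_iff', modelJ_zero_apply, modelMetric_apply, coneBracket, bracket, z, tau,
        Fin.forall_fin_succ, Fin.sum_univ_three, Fin.sum_univ_four]
  have h23 : modelMetric (Γ (z 0, 0) (tau 2, 0)) (tau 3, 0) = a - lam := by
    apply christoffel_eq_sub (s := (0, 1)) modelMetric_comm hΓ hT hj0 (modelMetric_modelJ 0) <;>
      simp [ext_iff', modelJ_zero_apply, modelMetric_apply, coneBracket, bracket, z, tau,
        Fin.forall_fin_succ, Fin.sum_univ_three, Fin.sum_univ_four]
  -- J₂ maps τ₃ to τ₁ but τ₄ to -τ₂, so its parallelism turns `h01` and `h23` into a - λ = -(a - λ).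
  have e0 : ((tau 0, 0) : QHeis × ℝ) = modelJ 1 (tau 2, 0) := by
    simp [ext_iff', modelJ_one_apply, tau, Fin.forall_fin_succ]
  have e1 : ((tau 1, 0) : QHeis × ℝ) = -modelJ 1 (tau 3, 0) := by
    simp [ext_iff', modelJ_one_apply, tau, Fin.forall_fin_succ]
  rw [e0, e1, hj1, map_neg, modelMetric_modelJ, h23] at h01
  linarith

end QHeis
end

open QHeis in
/-- The cone `(N₁ × ℝ⁺, a² r² g_λ + dr²)` is `8`-dimensional, and with the almost complex structures
`J₁, J₂, J₃` induced by the almost contact metric `3`-structure (which satisfy `J₂ J₁ = J₃`) it is a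
hyper-Kähler manifold with torsion exactly when the cone constant `a` equals `λ`. -/
theorem theorem2p10 (lam : ℝ) (hlam : 0 < lam) :
    Module.finrank ℝ (QHeis × ℝ) = 8 ∧
    IsHKTOn 𝓘(ℝ, QHeis × ℝ) cone (coneMetric lam lam)
      (coneJ lam lam 1) (coneJ lam lam 0) (coneJ lam lam 2) ∧
    ∀ a : ℝ, 0 < a →
      (IsHKTOn 𝓘(ℝ, QHeis × ℝ) cone (coneMetric lam a)
        (coneJ lam a 1) (coneJ lam a 0) (coneJ lam a 2) ↔ a = lam) := by
  refine ⟨?_, isHKTOn_cone hlam, fun a ha => ⟨eq_of_isHKTOn_cone hlam ha, ?_⟩⟩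
  · rw [Module.finrank_prod]
    change Module.finrank ℝ ((Fin 3 → ℝ) × (Fin 4 → ℝ)) + _ = 8
    simp
  · rintro rfl
    exact isHKTOn_cone hlam
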